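/- Let $n$ be a positive integer, let $M_n$ be the algebra of complex $n\times n$ matrices with matrix units $E_{ij}$, and let $\Delta_n=\{(i,i):1\le i\le n\}$. A quasi-order on $\{1,\dots,n\}$ is a reflexive transitive relation $\rho\subseteq\{1,\dots,n\}^2$; its structural matrix algebra is $$\mathcal A_\rho=\{A\in M_n : A_{ij}\neq 0\Rightarrow (i,j)\in\rho\}=\operatorname{span}\{E_{ij}:(i,j)\in\rho\}.$$ Let $\approx$ be the equivalence relation on $\{1,\dots,n\}$ that is the transitive closure of the relation "$(i,j)\in\rho$ or $(j,i)\in\rho$". The algebra $\mathcal A_\rho$ is called $2$-free if no equivalence class of $\approx$ has exactly two elements. A map $g:\rho\to\mathbb C^\times$ is called transitive if $g(i,j)g(j,k)=g(i,k)$ for all $(i,j),(j,k)\in\rho$. Let $\rho$ be a quasi-order on $\{1,\dots,n\}$ such that $\mathcal A_\rho$ is $2$-free, and let $\varphi:\mathcal A_\rho\to M_n$ be an injective continuous (not necessarily linear) map that preserves commutativity ($XY=YX$ implies $\varphi(X)\varphi(Y)=\varphi(Y)\varphi(X)$ for all $X,Y\in\mathcal A_\rho$) and spectrum (the set of eigenvalues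 of $\varphi(X)$ equals that of $X$ for every $X\in\mathcal A_\rho$). Then there exist an invertible matrix $S\in M_n$, a transitive map $g:\rho\to\mathbb C^\times$ and quasi-orders $\rho_M,\rho_A\subseteq\rho$ on $\{1,\dots,n\}$ such that $\rho_M\cup\rho_A=\rho$, $\rho_M\cap\rho_A=\Delta_n$ and, for all $(i,j)\in\rho$, $$\varphi(E_{ij})=\begin{cases} g(i,j)\,S E_{ij}S^{-1}, & (i,j)\in\rho_M,\\ g(i,j)\,S E_{ji}S^{-1}, & (i,j)\in\rho_A.\end{cases}$$ -/

import Mathlib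

namespace SMA

/-- A quasi-order on `{1, …, n}` (indexed by `Fin n`): a reflexive transitive binary relation,
given as a set of pairs. -/
structure IsQuasiOrder {n : ℕ} (ρ : Set (Fin n × Fin n)) : Prop where
  refl : ∀ i, (i, i) ∈ ρ
  trans : ∀ i j k, (i, j) ∈ ρ → (j, k) ∈ ρ → (i, k) ∈ ρ

/-- The structural matrix algebra `A_ρ`: all complex `n × n` matrices supported in `ρ`. -/
def algebra {n : ℕ} (ρ : Set (Fin n × Fin n)) (hρ : IsQuasiOrder ρ) :
    Subalgebra ℂ (Matrix (Fin n) (Fin n) ℂ) where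
  carrier := {A | ∀ i j, A i j ≠ 0 → (i, j) ∈ ρ}
  mul_mem' := by
    intro A B hA hB i j hij
    rw [Matrix.mul_apply] at hij
    obtain ⟨k, -, hk⟩ := Finset.exists_ne_zero_of_sum_ne_zero hij
    exact hρ.trans i k j (hA i k (left_ne_zero_of_mul hk)) (hB k j (right_ne_zero_of_mul hk))
  add_mem' := by
    intro A B hA hB i j hij
    by_contra h
    have h1 : A i j = 0 := by
      by_contra h1
      exact h (hA i j h1)
    have h2 : B i j = 0 := by
      by_contra h2
      exact h (hB i j h2)
    exact hij (by rw [Matrix.add_apply, h1, h2, add_zero])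
  algebraMap_mem' := by
    intro c i j hij
    by_cases h : i = j
    · subst h
      exact hρ.refl i
    · exact absurd (by rw [Matrix.algebraMap_matrix_apply, if_neg h]) hij

/-- The matrix unit `E_ij`, for `(i, j) ∈ ρ`, as an element of `A_ρ`. -/
def matrixUnit {n : ℕ} {ρ : Set (Fin n × Fin n)} (hρ : IsQuasiOrder ρ) {i j : Fin n}
    (h : (i, j) ∈ ρ) : algebra ρ hρ :=
  ⟨Matrix.single i j 1, by
    intro k l hkl
    by_cases h' : i = k ∧ j = l
    · obtain ⟨rfl, rfl⟩ := h'
      exact h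
    · exact absurd (by simp only [Matrix.single_apply, if_neg h']) hkl⟩

/-- The symmetrized relation: `(i, j) ∈ ρ` or `(j, i) ∈ ρ`. -/
def symmRel {n : ℕ} (ρ : Set (Fin n × Fin n)) (i j : Fin n) : Prop :=
  (i, j) ∈ ρ ∨ (j, i) ∈ ρ

/-- The transitive closure of the symmetrized relation of a quasi-order,
as an equivalence relation. -/
def connected {n : ℕ} (ρ : Set (Fin n × Fin n)) (hρ : IsQuasiOrder ρ) : Setoid (Fin n) where
  r := Relation.TransGen (symmRel ρ)
  iseqv :=
    { refl := fun i => Relation.TransGen.single (Or.inl (hρ.refl i))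
      symm := fun h => by
        induction h with
        | single h => exact Relation.TransGen.single h.symm
        | tail _ h ih => exact Relation.TransGen.head h.symm ih
      trans := Relation.TransGen.trans }

/-- `A_ρ` is 2-free: no equivalence class has exactly two elements. -/
def IsTwoFree {n : ℕ} (ρ : Set (Fin n × Fin n)) (hρ : IsQuasiOrder ρ) : Prop :=
  ∀ C ∈ (connected ρ hρ).classes, C.ncard ≠ 2

/-- A transitive map `g : ρ → ℂ^×`. -/
def IsTransitiveMap {n : ℕ} {ρ : Set (Fin n × Fin n)} (hρ : IsQuasiOrder ρ) (g : ρ → ℂˣ) :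
    Prop :=
  ∀ (i j k : Fin n) (hij : (i, j) ∈ ρ) (hjk : (j, k) ∈ ρ),
    g ⟨(i, j), hij⟩ * g ⟨(j, k), hjk⟩ = g ⟨(i, k), hρ.trans i j k hij hjk⟩

/-- `φ` preserves commutativity (in one direction). -/
def PreservesCommutativity {n : ℕ} {A : Subalgebra ℂ (Matrix (Fin n) (Fin n) ℂ)}
    (φ : A → Matrix (Fin n) (Fin n) ℂ) : Prop :=
  ∀ X Y : A, X * Y = Y * X → φ X * φ Y = φ Y * φ X

/-- `φ` preserves the spectrum (as a set). -/
def PreservesSpectrum {n : ℕ} {A : Subalgebra ℂ (Matrix (Fin n) (Fin n) ℂ)}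
    (φ : A → Matrix (Fin n) (Fin n) ℂ) : Prop :=
  ∀ X : A, spectrum ℂ (φ X) = spectrum ℂ (X : Matrix (Fin n) (Fin n) ℂ)

end SMA

namespace SMA

open Matrix

/-! Conjugation and continuity make `φ` fix every diagonal matrix (`exists_isNormalized`,
`apply_diag_eq_self`). Commuting with the diagonal idempotents then confines the off-diagonal part
of `φ(E_ij)` to the positions (i,j) and (j,i).

Two units sharing a source or a target commute. This forces both images to be multiples of matrix
units with the same orientation (`eq_single_of_commute_blocks`). Being 2-free gives every
off-diagonal pair of `ρ` such a partner, and orientation spreads along composable pairs, so the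
direct and the reversed pairs are each transitive.

Transitivity of the coefficients is the hard part, since `φ` is not linear. In `coeff_mul_coeff`,
auxiliary families of matrices X with X² = tX have images known up to a few entries. Commutation
yields a product formula for t ≠ 0, and t → 0 gives the claim for matrix units. Transposition
reduces reversed pairs to direct ones. -/

/-! ### Spectra and commutation of explicit matrices -/

theorem mem_spectrum_of_col {n : ℕ} {M : Matrix (Fin n) (Fin n) ℂ} {m : Fin n}
    (h : ∀ r, r ≠ m → M r m = 0) : M m m ∈ spectrum ℂ M := by
  rw [spectrum.mem_iff, Matrix.isUnit_iff_isUnit_det, Matrix.det_eq_zero_of_column_eq_zero m]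
  · exact not_isUnit_zero
  · intro r
    by_cases hr : r = m
    · subst hr; simp [Matrix.algebraMap_matrix_apply]
    · simp [Matrix.algebraMap_matrix_apply, hr, h r hr]

theorem mem_spectrum_of_row {n : ℕ} {M : Matrix (Fin n) (Fin n) ℂ} {m : Fin n}
    (h : ∀ r, r ≠ m → M m r = 0) : M m m ∈ spectrum ℂ M := by
  rw [spectrum.mem_iff, Matrix.isUnit_iff_isUnit_det, Matrix.det_eq_zero_of_row_eq_zero m]
  · exact not_isUnit_zero
  · intro r
    by_cases hr : r = m
    · subst hr; simp [Matrix.algebraMap_matrix_apply]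
    · simp [Matrix.algebraMap_matrix_apply, Ne.symm hr, h r hr]

/-- Since (a - M)((a - t) + M) = a(a - t), the resolvent is explicit whenever this scalar is
nonzero. -/
theorem eq_or_eq_of_mem_spectrum {n : ℕ} {M : Matrix (Fin n) (Fin n) ℂ} {t a : ℂ}
    (hM : M * M = t • M) (ha : a ∈ spectrum ℂ M) : a = 0 ∨ a = t := by
  by_contra! h
  apply ha
  have hc : a * (a - t) ≠ 0 := mul_ne_zero h.1 (sub_ne_zero.2 h.2)
  have h1 : (a • 1 - M) * ((a - t) • 1 + M) = (a * (a - t)) • 1 := by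
    simp only [mul_add, sub_mul, smul_mul_assoc, mul_smul_comm, one_mul, mul_one, hM]
    module
  have h2 : ((a - t) • 1 + M) * (a • 1 - M) = (a * (a - t)) • 1 := by
    simp only [mul_sub, add_mul, smul_mul_assoc, mul_smul_comm, one_mul, mul_one, hM]
    module
  rw [spectrum.mem_resolventSet_iff, Algebra.algebraMap_eq_smul_one]
  refine ⟨⟨a • 1 - M, (a * (a - t))⁻¹ • ((a - t) • 1 + M), ?_, ?_⟩, rfl⟩
  · rw [mul_smul_comm, h1, inv_smul_smul₀ hc]
  · rw [smul_mul_assoc, h2, inv_smul_smul₀ hc]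

theorem apply_eq_zero_of_commute_diagonal {n : ℕ} {M : Matrix (Fin n) (Fin n) ℂ} {d : Fin n → ℂ}
    (h : M * diagonal d = diagonal d * M) {r s : Fin n} (hd : d r ≠ d s) : M r s = 0 := by
  have h1 := congr_fun (congr_fun h r) s
  rw [mul_diagonal, diagonal_mul] at h1
  have h2 : (d r - d s) * M r s = 0 := by linear_combination -h1
  exact (mul_eq_zero.1 h2).resolve_left (sub_ne_zero.2 hd)

theorem exists_conj_eq_diagonal {n : ℕ} (A : Matrix (Fin n) (Fin n) ℂ) (d : Fin n → ℂ)
    (hd : Function.Injective d) (hA : ∀ i, d i ∈ spectrum ℂ A) :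
    ∃ P : (Matrix (Fin n) (Fin n) ℂ)ˣ, A * P = P * diagonal d := by
  have h1 : ∀ i, ∃ v, Module.End.HasEigenvector (toLin' A) (d i) v := fun i => by
    refine Module.End.HasEigenvalue.exists_hasEigenvector ?_
    rw [Module.End.hasEigenvalue_iff_mem_spectrum, spectrum_toLin']
    exact hA i
  choose v hv using h1
  have h2 := Module.End.eigenvectors_linearIndependent' (toLin' A) d hd v hv
  have h3 : IsUnit (Matrix.of fun i j => v j i) := linearIndependent_cols_iff_isUnit.1 h2
  refine ⟨h3.unit, ?_⟩
  ext r s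
  have h4 := congr_fun (hv s).apply_eq_smul r
  rw [toLin'_apply] at h4
  rw [mul_diagonal, IsUnit.unit_spec, mul_apply]
  simpa [mulVec, dotProduct, mul_comm] using h4

theorem eq_of_continuous_of_finite {f : ℂ → ℂ} (hf : Continuous f) {s : Set ℂ} (hs : s.Finite)
    (h : ∀ u, f u ∈ s) (u v : ℂ) : f u = f v :=
  isPreconnected_univ.constant_of_mapsTo (T := s)
    (isDiscrete_iff_discreteTopology.2 <| by exact hs.instDiscreteTopology) hf.continuousOn (fun u _ => h u)
    trivial trivial

/-! ### Normalization on diagonal matrices -/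

/-- Along the complex line from `X₀` to `X`, commutation with `X₀` keeps images diagonal, and the
spectrum makes each entry one of the `z l u`. Away from finitely many collisions the label l cannot
jump, because ℂ minus a finite set is connected; density covers the collisions, including possibly
`X` itself. -/
theorem apply_diag_eq_self {n : ℕ} {ρ : Set (Fin n × Fin n)} {hρ : IsQuasiOrder ρ}
    {φ : algebra ρ hρ → Matrix (Fin n) (Fin n) ℂ} (hcont : Continuous φ)
    (hcomm : PreservesCommutativity φ) (hspec : PreservesSpectrum φ)
    {d₀ : Fin n → ℂ} (hd₀ : Function.Injective d₀) {X₀ : algebra ρ hρ}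
    (hX₀ : (X₀ : Matrix (Fin n) (Fin n) ℂ) = diagonal d₀) (hφ : φ X₀ = diagonal d₀)
    {X : algebra ρ hρ} {d : Fin n → ℂ} (hX : (X : Matrix (Fin n) (Fin n) ℂ) = diagonal d) :
    φ X = diagonal d := by
  set Z : ℂ → algebra ρ hρ := fun u => (1 - u) • X₀ + u • X with hZ
  set z : Fin n → ℂ → ℂ := fun m u => (1 - u) * d₀ m + u * d m with hz
  have hZz : ∀ u, (Z u : Matrix (Fin n) (Fin n) ℂ) = diagonal fun m => z m u := by
    intro u
    ext r s
    by_cases h : r = s <;> simp [hZ, hz, hX₀, hX, h]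
  have hZc : Continuous Z := by fun_prop
  have hoff : ∀ u r s, r ≠ s → φ (Z u) r s = 0 := by
    intro u r s hrs
    refine apply_eq_zero_of_commute_diagonal (d := d₀) ?_ (hd₀.ne hrs)
    rw [← hφ]
    refine hcomm _ _ (Subtype.ext ?_)
    simp only [MulMemClass.coe_mul, hZz, hX₀, diagonal_mul_diagonal, mul_comm]
  have hmem : ∀ u m, ∃ l, φ (Z u) m m = z l u := by
    intro u m
    have := mem_spectrum_of_col (M := φ (Z u)) (m := m) fun r hr => hoff u r m hr
    rw [hspec, hZz, spectrum_diagonal] at this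
    obtain ⟨l, hl⟩ := this
    exact ⟨l, hl.symm⟩
  set T : Set ℂ := ⋃ p : {p : Fin n × Fin n // p.1 ≠ p.2}, {u | z p.1.1 u = z p.1.2 u} with hT
  have hTfin : T.Finite := by
    refine Set.finite_iUnion fun p => Set.Subsingleton.finite ?_
    intro u hu v hv
    have hne : d₀ p.1.1 - d₀ p.1.2 ≠ 0 := sub_ne_zero.2 (hd₀.ne p.2)
    simp only [hz, Set.mem_ofPred_eq] at hu hv
    have : (u - v) * (d₀ p.1.1 - d₀ p.1.2) = 0 := by
      linear_combination u * hv - v * hu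
    exact sub_eq_zero.1 ((mul_eq_zero.1 this).resolve_right hne)
  have hTconn : IsPreconnected Tᶜ :=
    (hTfin.countable.isConnected_compl_of_one_lt_rank
      (Complex.rank_real_complex ▸ Nat.one_lt_ofNat)).isPreconnected
  have hinT : ∀ u l m, l ≠ m → z l u = z m u → u ∈ T := fun u l m hlm h =>
    Set.mem_iUnion.2 ⟨⟨(l, m), hlm⟩, h⟩
  have hzc : ∀ m, Continuous (z m) := fun m => by fun_prop
  have hfc : ∀ m, Continuous fun u => φ (Z u) m m := fun m =>
    (hcont.comp hZc).matrix_elem m m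
  have h0 : (0 : ℂ) ∈ Tᶜ := by
    simp only [hT, hz, Set.mem_compl_iff, Set.mem_iUnion, not_exists, Set.mem_ofPred_eq]
    intro p hp
    exact p.2 (hd₀ (by simpa using hp))
  have hZ0 : φ (Z 0) = diagonal d₀ := by simp [hZ, hφ]
  have key : ∀ m, ∀ u ∈ Tᶜ, φ (Z u) m m = z m u := by
    intro m u hu
    by_contra hne
    -- The closed sets "label m" and "some other label" cover `Tᶜ` and can meet only inside `T`.
    have := isPreconnected_closed_iff.1 hTconn {u | φ (Z u) m m = z m u}
      (⋃ l : {l : Fin n // l ≠ m}, {u | φ (Z u) m m = z l u})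
      (isClosed_eq (hfc m) (hzc m))
      (isClosed_iUnion_of_finite fun l => isClosed_eq (hfc m) (hzc l))
      (fun v _ => by
        obtain ⟨l, hl⟩ := hmem v m
        by_cases hlm : l = m
        · exact Or.inl (hlm ▸ hl)
        · exact Or.inr (Set.mem_iUnion.2 ⟨⟨l, hlm⟩, hl⟩))
      ⟨0, h0, by simp [hZ0, hz]⟩
      ⟨u, hu, by
        obtain ⟨l, hl⟩ := hmem u m
        refine Set.mem_iUnion.2 ⟨⟨l, ?_⟩, hl⟩
        rintro rfl
        exact hne hl⟩
    obtain ⟨v, hv, hv1, hv2⟩ := this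
    obtain ⟨l, hl⟩ := Set.mem_iUnion.1 hv2
    exact hv (hinT v l m l.2 (hl.symm.trans hv1))
  have hall : ∀ m u, φ (Z u) m m = z m u := by
    intro m u
    have hd : Dense Tᶜ := hTfin.countable.dense_compl ℝ
    exact congr_fun (Continuous.ext_on hd (hfc m) (hzc m) (key m)) u
  have hZ1 : Z 1 = X := by simp [hZ]
  ext r s
  rw [← hZ1]
  by_cases h : r = s
  · subst h
    rw [hall]
    simp [hz]
  · rw [hoff 1 r s h, diagonal_apply_ne _ h]

/-- A continuous injective map on `A_ρ` that preserves commutativity and spectrum, and fixes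
every diagonal matrix. -/
structure IsNormalized {n : ℕ} {ρ : Set (Fin n × Fin n)} {hρ : IsQuasiOrder ρ}
    (φ : algebra ρ hρ → Matrix (Fin n) (Fin n) ℂ) : Prop where
  inj : Function.Injective φ
  cont : Continuous φ
  comm : PreservesCommutativity φ
  spec : PreservesSpectrum φ
  diag : ∀ (X : algebra ρ hρ) (d : Fin n → ℂ),
    (X : Matrix (Fin n) (Fin n) ℂ) = diagonal d → φ X = diagonal d

/-- The image of diag(0, …, n-1) has n distinct eigenvalues, so an eigenbasis conjugates it back to
that diagonal matrix. -/
theorem exists_isNormalized {n : ℕ} {ρ : Set (Fin n × Fin n)} {hρ : IsQuasiOrder ρ}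
    {φ : algebra ρ hρ → Matrix (Fin n) (Fin n) ℂ} (hinj : Function.Injective φ)
    (hcont : Continuous φ) (hcomm : PreservesCommutativity φ) (hspec : PreservesSpectrum φ) :
    ∃ (S : (Matrix (Fin n) (Fin n) ℂ)ˣ) (ψ : algebra ρ hρ → Matrix (Fin n) (Fin n) ℂ),
      IsNormalized ψ ∧ ∀ X, φ X = S * ψ X * (S⁻¹ : (Matrix (Fin n) (Fin n) ℂ)ˣ) := by
  set d₀ : Fin n → ℂ := fun m => ((m : ℕ) : ℂ)
  have hd₀ : Function.Injective d₀ := fun a b h => Fin.ext (Nat.cast_injective h)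
  let X₀ : algebra ρ hρ := ⟨diagonal d₀, fun i j h => by
    by_cases hij : i = j
    · exact hij ▸ hρ.refl i
    · exact absurd (diagonal_apply_ne _ hij) h⟩
  obtain ⟨S, hS⟩ := exists_conj_eq_diagonal (φ X₀) d₀ hd₀ fun i => by
    rw [hspec]
    change d₀ i ∈ spectrum ℂ (diagonal d₀)
    rw [spectrum_diagonal]
    exact ⟨i, rfl⟩
  set ψ : algebra ρ hρ → Matrix (Fin n) (Fin n) ℂ := fun X =>
    (S⁻¹ : (Matrix (Fin n) (Fin n) ℂ)ˣ) * φ X * S with hψ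
  have hφψ : ∀ X, φ X = S * ψ X * (S⁻¹ : (Matrix (Fin n) (Fin n) ℂ)ˣ) := fun X => by
    simp [hψ, mul_assoc]
  have hψc : Continuous ψ := by fun_prop
  have hψcomm : PreservesCommutativity ψ := fun X Y h => by
    have := hcomm X Y h
    calc ψ X * ψ Y = (S⁻¹ : (Matrix (Fin n) (Fin n) ℂ)ˣ) * (φ X * φ Y) * S := by
          simp [hψ, mul_assoc]
      _ = ψ Y * ψ X := by rw [this]; simp [hψ, mul_assoc]
  have hψs : PreservesSpectrum ψ := fun X => by
    rw [← hspec X]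
    exact spectrum.units_conjugate'
  refine ⟨S, ψ, ⟨fun X Y h => hinj (by rw [hφψ X, hφψ Y, h]), hψc, hψcomm, hψs, ?_⟩, hφψ⟩
  intro X d hX
  refine apply_diag_eq_self hψc hψcomm hψs hd₀ (X₀ := X₀) rfl ?_ hX
  simp [hψ, mul_assoc, hS]

/-- Exchanges direct and reversed pairs, so results on direct pairs suffice. -/
theorem IsNormalized.transpose {n : ℕ} {ρ : Set (Fin n × Fin n)} {hρ : IsQuasiOrder ρ}
    {φ : algebra ρ hρ → Matrix (Fin n) (Fin n) ℂ} (hφ : IsNormalized φ) :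
    IsNormalized fun X => (φ X)ᵀ where
  inj X Y h := hφ.inj (transpose_injective h)
  cont := hφ.cont.matrix_transpose
  comm X Y h := by
    simp only [← transpose_mul]
    rw [hφ.comm X Y h]
  spec X := by
    rw [← hφ.spec X]
    ext a
    simp only [spectrum.mem_iff]
    rw [← isUnit_transpose (algebraMap ℂ _ a - φ X)]
    simp [Algebra.algebraMap_eq_smul_one]
  diag X d h := by simp [hφ.diag X d h]

/-! ### Matrices commuting with units or with each other -/

theorem mul_single_apply {n : ℕ} (M : Matrix (Fin n) (Fin n) ℂ) (a b r s : Fin n) (c : ℂ) :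
    (M * single a b c) r s = if b = s then M r a * c else 0 := by
  split_ifs with h
  · subst h; simp
  · exact mul_single_apply_of_ne _ _ _ _ _ (Ne.symm h) _

theorem single_mul_apply {n : ℕ} (M : Matrix (Fin n) (Fin n) ℂ) (a b r s : Fin n) (c : ℂ) :
    (single a b c * M) r s = if a = r then c * M b s else 0 := by
  split_ifs with h
  · subst h; simp
  · exact single_mul_apply_of_ne _ _ _ _ _ (Ne.symm h) _

theorem apply_eq_zero_of_commute_single {n : ℕ} {M : Matrix (Fin n) (Fin n) ℂ} {a b : Fin n}
    {c : ℂ} (hc : c ≠ 0) (h : M * single a b c = single a b c * M) :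
    (∀ r, r ≠ a → M r a = 0) ∧ ∀ s, s ≠ b → M b s = 0 := by
  constructor
  · intro r hr
    have h1 := congr_fun (congr_fun h r) b
    simpa [mul_single_apply, single_mul_apply, hr.symm, hc] using h1
  · intro s hs
    have h1 := congr_fun (congr_fun h a) s
    simpa [mul_single_apply, single_mul_apply, hs.symm, hc] using h1

/-- Two commuting nonzero quasi-nilpotent matrices supported in `2 × 2` blocks sharing one index
are, up to scalars, matrix units with that index in the same position. -/
theorem eq_single_of_commute_blocks {n : ℕ} {M N : Matrix (Fin n) (Fin n) ℂ} {i j k : Fin n}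
    (hij : i ≠ j) (hik : i ≠ k) (hjk : j ≠ k)
    (hM : ∀ r s, r ≠ s → ¬(r = i ∧ s = j) → ¬(r = j ∧ s = i) → M r s = 0)
    (hN : ∀ r s, r ≠ s → ¬(r = i ∧ s = k) → ¬(r = k ∧ s = i) → N r s = 0)
    (hMs : ∀ a ∈ spectrum ℂ M, a = 0) (hNs : ∀ a ∈ spectrum ℂ N, a = 0)
    (hM0 : M ≠ 0) (hN0 : N ≠ 0) (h : M * N = N * M) :
    ∃ a ≠ 0, ∃ b ≠ 0, (M = single i j a ∧ N = single i k b) ∨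
      (M = single j i a ∧ N = single k i b) := by
  have block : ∀ {K : Matrix (Fin n) (Fin n) ℂ} {l : Fin n}, i ≠ l →
      (∀ r s, r ≠ s → ¬(r = i ∧ s = l) → ¬(r = l ∧ s = i) → K r s = 0) →
      (∀ a ∈ spectrum ℂ K, a = 0) →
      K = single i i (K i i) + single i l (K i l) + single l i (K l i) + single l l (K l l) := by
    intro K l hil hK hKs
    ext r s
    by_cases hrs : r = s
    · subst hrs
      by_cases hr : r = i
      · subst hr; simp [hil.symm]
      by_cases hl : r = l
      · subst hl; simp [hil]
      have h0 : K r r = 0 :=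
        hKs _ (mem_spectrum_of_col fun t ht => hK t r ht (fun h => hl h.2) fun h => hr h.2)
      simp [h0, Ne.symm hr, Ne.symm hl]
    by_cases h1 : r = i ∧ s = l
    · obtain ⟨rfl, rfl⟩ := h1
      simp [hil.symm, hil]
    by_cases h2 : r = l ∧ s = i
    · obtain ⟨rfl, rfl⟩ := h2
      simp [hil.symm, hil]
    rw [hK r s hrs h1 h2]
    have h3 : ¬(i = r ∧ i = s) := fun h => hrs (h.1.symm.trans h.2)
    have h4 : ¬(l = r ∧ l = s) := fun h => hrs (h.1.symm.trans h.2)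
    have h5 : ¬(i = r ∧ l = s) := fun h => h1 ⟨h.1.symm, h.2.symm⟩
    have h6 : ¬(l = r ∧ i = s) := fun h => h2 ⟨h.1.symm, h.2.symm⟩
    simp only [Matrix.add_apply, single_apply, if_neg h3, if_neg h4, if_neg h5, if_neg h6,
      add_zero]
  -- Once the block is triangular, its diagonal entries are eigenvalues, hence zero.
  have tri : ∀ {K : Matrix (Fin n) (Fin n) ℂ} {l : Fin n}, i ≠ l →
      (∀ r s, r ≠ s → ¬(r = i ∧ s = l) → ¬(r = l ∧ s = i) → K r s = 0) →
      (∀ a ∈ spectrum ℂ K, a = 0) → (K i l = 0 ∨ K l i = 0) → K i i = 0 ∧ K l l = 0 := by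
    intro K l hil hK hKs h0
    rcases h0 with h0 | h0
    · refine ⟨hKs _ (mem_spectrum_of_row fun t ht => ?_),
        hKs _ (mem_spectrum_of_col fun t ht => ?_)⟩
      · by_cases htl : t = l
        · rwa [htl]
        · exact hK _ _ ht.symm (by tauto) (by tauto)
      · by_cases htl : t = i
        · rwa [htl]
        · exact hK _ _ ht (by tauto) (by tauto)
    · refine ⟨hKs _ (mem_spectrum_of_col fun t ht => ?_),
        hKs _ (mem_spectrum_of_row fun t ht => ?_)⟩
      · by_cases htl : t = l
        · rwa [htl]
        · exact hK _ _ ht (by tauto) (by tauto)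
      · by_cases htl : t = i
        · rwa [htl]
        · exact hK _ _ ht.symm (by tauto) (by tauto)
  have hMb := block hij hM hMs
  have hNb := block hik hN hNs
  have triM := tri hij hM hMs
  have triN := tri hik hN hNs
  generalize M i i = a, M i j = b, M j i = c, M j j = d at hMb triM
  generalize N i i = a', N i k = b', N k i = c', N k k = d' at hNb triN
  subst hMb hNb
  -- The (j,k) and (k,j) entries of MN = NM give c b' = 0 and c' b = 0, which rules out mixed
  -- orientations.
  have e1 := congr_fun (congr_fun h j) k
  have e2 := congr_fun (congr_fun h k) j
  simp [mul_add, add_mul, hij, hik, hjk, hij.symm, hik.symm, hjk.symm] at e1 e2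
  have z1 : b ≠ 0 ∨ c ≠ 0 := by
    by_contra! hbc
    obtain ⟨ha, hd⟩ := triM (Or.inl hbc.1)
    exact hM0 (by simp [ha, hd, hbc.1, hbc.2])
  have z2 : b' ≠ 0 ∨ c' ≠ 0 := by
    by_contra! hbc
    obtain ⟨ha, hd⟩ := triN (Or.inl hbc.1)
    exact hN0 (by simp [ha, hd, hbc.1, hbc.2])
  by_cases hc : c = 0
  · have hb : b ≠ 0 := z1.resolve_right (not_not.2 hc)
    have hc' : c' = 0 := by tauto
    have hb' : b' ≠ 0 := z2.resolve_right (not_not.2 hc')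
    obtain ⟨ha, hd⟩ := triM (Or.inr hc)
    obtain ⟨ha', hd'⟩ := triN (Or.inr hc')
    exact ⟨b, hb, b', hb', Or.inl ⟨by simp [ha, hd, hc], by simp [ha', hd', hc']⟩⟩
  · have hb' : b' = 0 := by tauto
    have hc' : c' ≠ 0 := z2.resolve_left (not_not.2 hb')
    have hb : b = 0 := by tauto
    obtain ⟨ha, hd⟩ := triM (Or.inl hb)
    obtain ⟨ha', hd'⟩ := triN (Or.inl hb')
    exact ⟨c, hc, c', hc', Or.inr ⟨by simp [ha, hd, hb], by simp [ha', hd', hb']⟩⟩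

/-! ### Images of matrix units -/

section Units

variable {n : ℕ} {ρ : Set (Fin n × Fin n)} {hρ : IsQuasiOrder ρ}

theorem matrixUnit_mul_same {i j k : Fin n} (hij : (i, j) ∈ ρ) (hjk : (j, k) ∈ ρ) :
    matrixUnit hρ hij * matrixUnit hρ hjk = matrixUnit hρ (hρ.trans _ _ _ hij hjk) :=
  Subtype.ext (by simp [matrixUnit])

theorem matrixUnit_mul_of_ne {i j k l : Fin n} (hij : (i, j) ∈ ρ) (hkl : (k, l) ∈ ρ)
    (h : j ≠ k) : matrixUnit hρ hij * matrixUnit hρ hkl = 0 :=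
  Subtype.ext (by simp [matrixUnit, h])

theorem matrixUnit_ne_zero {i j : Fin n} (hij : (i, j) ∈ ρ) : matrixUnit hρ hij ≠ 0 := by
  intro h
  have := congr_fun (congr_fun (congr_arg Subtype.val h) i) j
  simp [matrixUnit] at this

namespace IsNormalized

variable {φ : algebra ρ hρ → Matrix (Fin n) (Fin n) ℂ}

theorem map_smul_unit_self (hφ : IsNormalized φ) (m : Fin n) (t : ℂ) :
    φ (t • matrixUnit hρ (hρ.refl m)) = single m m t := by
  rw [← diagonal_single]
  exact hφ.diag _ _ (by simp [matrixUnit, diagonal_single])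

theorem map_unit_self (hφ : IsNormalized φ) (m : Fin n) :
    φ (matrixUnit hρ (hρ.refl m)) = single m m 1 := by
  simpa using hφ.map_smul_unit_self m 1

theorem map_zero (hφ : IsNormalized φ) : φ 0 = 0 := by
  rw [hφ.diag 0 0] <;> simp

theorem map_apply_eq_zero (hφ : IsNormalized φ) {X : algebra ρ hρ} {m : Fin n}
    (h : X * matrixUnit hρ (hρ.refl m) = matrixUnit hρ (hρ.refl m) * X) :
    (∀ r, r ≠ m → φ X r m = 0) ∧ ∀ s, s ≠ m → φ X m s = 0 := by
  have := hφ.comm _ _ h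
  rw [hφ.map_unit_self] at this
  exact apply_eq_zero_of_commute_single one_ne_zero this

theorem mem_spectrum_map (hφ : IsNormalized φ) {X : algebra ρ hρ} {t a : ℂ}
    (hX : X * X = t • X) (ha : a ∈ spectrum ℂ (φ X)) : a = 0 ∨ a = t := by
  rw [hφ.spec] at ha
  exact eq_or_eq_of_mem_spectrum (congr_arg Subtype.val hX) ha

/-- A continuous function on ℂ with values in {0, t} is constant. -/
theorem map_diag_apply_eq (hφ : IsNormalized φ) {Z : ℂ → algebra ρ hρ} (hZ : Continuous Z)
    {t : ℂ} (hZt : ∀ u, Z u * Z u = t • Z u) {m : Fin n}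
    (hm : ∀ u, φ (Z u) m m ∈ spectrum ℂ (φ (Z u))) (u : ℂ) : φ (Z u) m m = φ (Z 0) m m :=
  eq_of_continuous_of_finite (f := fun u => φ (Z u) m m) (s := {0, t})
    ((hφ.cont.comp hZ).matrix_elem m m) (by simp)
    (fun u => hφ.mem_spectrum_map (hZt u) (hm u)) u 0

/-- `E_ij` commutes with `E_mm` for m outside {i, j}, which isolates row and column m of the image.
-/
theorem map_unit_block (hφ : IsNormalized φ) {i j : Fin n} (hij : (i, j) ∈ ρ) {r s : Fin n}
    (hrs : r ≠ s) (h1 : ¬(r = i ∧ s = j)) (h2 : ¬(r = j ∧ s = i)) :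
    φ (matrixUnit hρ hij) r s = 0 := by
  by_cases hr : r = i ∨ r = j
  · have hi : i ≠ s := by rintro rfl; tauto
    have hj : j ≠ s := by rintro rfl; tauto
    refine (hφ.map_apply_eq_zero (m := s) ?_).1 r hrs
    rw [matrixUnit_mul_of_ne _ _ hj, matrixUnit_mul_of_ne _ _ hi.symm]
  · push Not at hr
    refine (hφ.map_apply_eq_zero (m := r) ?_).2 s hrs.symm
    rw [matrixUnit_mul_of_ne _ _ hr.2.symm, matrixUnit_mul_of_ne _ _ hr.1]

theorem spectrum_map_unit (hφ : IsNormalized φ) {i j : Fin n} (hij : (i, j) ∈ ρ) (hne : i ≠ j) :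
    ∀ a ∈ spectrum ℂ (φ (matrixUnit hρ hij)), a = 0 := fun a ha => by
  have := hφ.mem_spectrum_map (t := 0)
    (by rw [matrixUnit_mul_of_ne _ _ hne.symm, zero_smul]) ha
  simpa using this

theorem map_unit_ne_zero (hφ : IsNormalized φ) {i j : Fin n} (hij : (i, j) ∈ ρ) :
    φ (matrixUnit hρ hij) ≠ 0 := by
  rw [← hφ.map_zero]
  exact hφ.inj.ne (matrixUnit_ne_zero hij)

end IsNormalized

/-! ### Orientation of pairs and its propagation -/

/-- `φ` maps `E_ij` to a nonzero multiple of `E_ij`. -/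
def IsDirect (φ : algebra ρ hρ → Matrix (Fin n) (Fin n) ℂ) (i j : Fin n) : Prop :=
  ∃ h : (i, j) ∈ ρ, ∃ c ≠ 0, φ (matrixUnit hρ h) = single i j c

/-- `φ` maps `E_ij` to a nonzero multiple of `E_ji`. -/
def IsReversed (φ : algebra ρ hρ → Matrix (Fin n) (Fin n) ℂ) (i j : Fin n) : Prop :=
  ∃ h : (i, j) ∈ ρ, ∃ c ≠ 0, φ (matrixUnit hρ h) = single j i c

theorem isReversed_iff {φ : algebra ρ hρ → Matrix (Fin n) (Fin n) ℂ} {i j : Fin n} :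
    IsReversed φ i j ↔ IsDirect (fun X => (φ X)ᵀ) i j := by
  refine exists_congr fun h => exists_congr fun c => and_congr_right fun _ => ?_
  rw [← transpose_inj, transpose_single]

theorem not_isDirect_and_isReversed {φ : algebra ρ hρ → Matrix (Fin n) (Fin n) ℂ} {i j : Fin n}
    (hne : i ≠ j) (h1 : IsDirect φ i j) (h2 : IsReversed φ i j) : False := by
  obtain ⟨_, c, hc, h1⟩ := h1
  obtain ⟨_, d, hd, h2⟩ := h2
  have := congr_fun (congr_fun (h1.symm.trans h2) i) j
  simp [hne.symm, hc] at this

/-- Transitivity turns any link from {i, j} to an outside k into (i,k) or (k,j); without one, {i, j}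
would be a full class. -/
theorem exists_third (h2 : IsTwoFree ρ hρ) {i j : Fin n} (hij : (i, j) ∈ ρ) (hne : i ≠ j) :
    ∃ k, k ≠ i ∧ k ≠ j ∧ ((i, k) ∈ ρ ∨ (k, j) ∈ ρ) := by
  by_contra! hcon
  have closed : ∀ a b, (a = i ∨ a = j) → symmRel ρ a b → (b = i ∨ b = j) := by
    rintro a b ha hab
    by_contra! hb
    have h3 := hcon b hb.1 hb.2
    rcases ha with rfl | rfl <;> rcases hab with hab | hab
    · exact h3.1 hab
    · exact h3.2 (hρ.trans _ _ _ hab hij)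
    · exact h3.1 (hρ.trans _ _ _ hij hab)
    · exact h3.2 hab
  refine h2 _ ⟨i, rfl⟩ ?_
  convert Set.ncard_pair hne using 2
  ext b
  constructor
  · intro hb
    have hb' : Relation.TransGen (symmRel ρ) i b := (connected ρ hρ).symm hb
    induction hb' with
    | single h => exact closed _ _ (Or.inl rfl) h
    | tail hab h ih => exact closed _ _ (ih ((connected ρ hρ).symm hab)) h
  · rintro (rfl | rfl)
    · exact (connected ρ hρ).refl _
    · exact Relation.TransGen.single (Or.inr hij)

namespace IsNormalized

variable {φ : algebra ρ hρ → Matrix (Fin n) (Fin n) ℂ}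

theorem same_type_of_source (hφ : IsNormalized φ) {i j k : Fin n} (hij : (i, j) ∈ ρ)
    (hik : (i, k) ∈ ρ) (nij : i ≠ j) (nik : i ≠ k) (njk : j ≠ k) :
    (IsDirect φ i j ∧ IsDirect φ i k) ∨ (IsReversed φ i j ∧ IsReversed φ i k) := by
  obtain ⟨a, ha, b, hb, h | h⟩ := eq_single_of_commute_blocks nij nik njk
    (fun r s h h1 h2 => hφ.map_unit_block hij h h1 h2)
    (fun r s h h1 h2 => hφ.map_unit_block hik h h1 h2)
    (hφ.spectrum_map_unit hij nij) (hφ.spectrum_map_unit hik nik)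
    (hφ.map_unit_ne_zero hij) (hφ.map_unit_ne_zero hik)
    (hφ.comm _ _ (by rw [matrixUnit_mul_of_ne _ _ nij.symm, matrixUnit_mul_of_ne _ _ nik.symm]))
  · exact Or.inl ⟨⟨hij, a, ha, h.1⟩, ⟨hik, b, hb, h.2⟩⟩
  · exact Or.inr ⟨⟨hij, a, ha, h.1⟩, ⟨hik, b, hb, h.2⟩⟩

theorem same_type_of_target (hφ : IsNormalized φ) {i j k : Fin n} (hji : (j, i) ∈ ρ)
    (hki : (k, i) ∈ ρ) (nij : i ≠ j) (nik : i ≠ k) (njk : j ≠ k) :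
    (IsDirect φ j i ∧ IsDirect φ k i) ∨ (IsReversed φ j i ∧ IsReversed φ k i) := by
  obtain ⟨a, ha, b, hb, h | h⟩ := eq_single_of_commute_blocks nij nik njk
    (fun r s h h1 h2 => hφ.map_unit_block hji h h2 h1)
    (fun r s h h1 h2 => hφ.map_unit_block hki h h2 h1)
    (hφ.spectrum_map_unit hji nij.symm) (hφ.spectrum_map_unit hki nik.symm)
    (hφ.map_unit_ne_zero hji) (hφ.map_unit_ne_zero hki)
    (hφ.comm _ _ (by rw [matrixUnit_mul_of_ne _ _ nik, matrixUnit_mul_of_ne _ _ nij]))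
  -- The shared index is now the target, so the two orientations swap.
  · exact Or.inr ⟨⟨hji, a, ha, h.1⟩, ⟨hki, b, hb, h.2⟩⟩
  · exact Or.inl ⟨⟨hji, a, ha, h.1⟩, ⟨hki, b, hb, h.2⟩⟩

theorem isDirect_self (hφ : IsNormalized φ) (i : Fin n) : IsDirect φ i i :=
  ⟨hρ.refl i, 1, one_ne_zero, hφ.map_unit_self i⟩

theorem isDirect_or_isReversed (hφ : IsNormalized φ) (h2 : IsTwoFree ρ hρ) {i j : Fin n}
    (hij : (i, j) ∈ ρ) : IsDirect φ i j ∨ IsReversed φ i j := by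
  by_cases nij : i = j
  · exact Or.inl (nij ▸ hφ.isDirect_self i)
  obtain ⟨k, nki, nkj, hk | hk⟩ := exists_third h2 hij nij
  · exact (hφ.same_type_of_source hij hk nij nki.symm nkj.symm).imp And.left And.left
  · exact (hφ.same_type_of_target hij hk (Ne.symm nij) nkj.symm nki.symm).imp And.left And.left

theorem isDirect_of_source (hφ : IsNormalized φ) {i j k : Fin n} (h : IsDirect φ i j)
    (hik : (i, k) ∈ ρ) (nij : i ≠ j) (njk : j ≠ k) : IsDirect φ i k := by
  by_cases nik : i = k
  · exact nik ▸ hφ.isDirect_self i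
  exact (hφ.same_type_of_source h.1 hik nij nik njk).elim And.right
    fun h' => (not_isDirect_and_isReversed nij h h'.1).elim

theorem isDirect_of_target (hφ : IsNormalized φ) {i j k : Fin n} (h : IsDirect φ j i)
    (hki : (k, i) ∈ ρ) (nij : i ≠ j) (njk : j ≠ k) : IsDirect φ k i := by
  by_cases nik : i = k
  · exact nik ▸ hφ.isDirect_self i
  exact (hφ.same_type_of_target h.1 hki nij nik njk).elim And.right
    fun h' => (not_isDirect_and_isReversed nij.symm h h'.1).elim

theorem isDirect_trans (hφ : IsNormalized φ) {i j k : Fin n} (hij : IsDirect φ i j)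
    (hjk : IsDirect φ j k) : IsDirect φ i k := by
  by_cases nij : i = j
  · exact nij ▸ hjk
  by_cases njk : j = k
  · exact njk ▸ hij
  exact hφ.isDirect_of_source hij (hρ.trans _ _ _ hij.1 hjk.1) nij njk

/-- The pair (i,k) shares its source with (i,j) and its target with (j,k), so it transmits the
orientation. If k = i it is diagonal, and a third index l serves as a detour. -/
theorem isDirect_of_adjacent (hφ : IsNormalized φ) (h2 : IsTwoFree ρ hρ) {i j k : Fin n}
    (hij : IsDirect φ i j) (hjk : (j, k) ∈ ρ) (nij : i ≠ j) : IsDirect φ j k := by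
  by_cases njk : j = k
  · exact njk ▸ hφ.isDirect_self j
  by_cases nik : i = k
  · subst nik
    obtain ⟨l, nli, nlj, hl | hl⟩ := exists_third h2 hij.1 nij
    · have hil := hφ.isDirect_of_source hij hl nij nlj.symm
      exact hφ.isDirect_of_source
        (hφ.isDirect_of_target hil (hρ.trans _ _ _ hjk hl) nli nij) hjk nlj.symm nli
    · have hlj := hφ.isDirect_of_target hij hl nij.symm nli.symm
      exact hφ.isDirect_of_target
        (hφ.isDirect_of_source hlj (hρ.trans _ _ _ hl hjk) nlj nij.symm) hjk nli.symm nlj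
  · exact hφ.isDirect_of_target
      (hφ.isDirect_of_source hij (hρ.trans _ _ _ hij.1 hjk) nij njk) hjk (Ne.symm nik) nij

/-! ### Multiplicativity of the coefficients -/

/-- With the (q,p) entry gone, the image is triangular, so its diagonal consists of eigenvalues in
{0, t} and stays frozen at its value for u = 0. Only the (p,q) entry remains unknown. -/
theorem map_add_smul_unit (hφ : IsNormalized φ) {p q m : Fin n} (hpq : (p, q) ∈ ρ) (hne : p ≠ q)
    (hm : m = p ∨ m = q) (t : ℂ)
    (htri : ∀ u : ℂ, φ (t • matrixUnit hρ (hρ.refl m) + u • matrixUnit hρ hpq) q p = 0) (u : ℂ) :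
    φ (t • matrixUnit hρ (hρ.refl m) + u • matrixUnit hρ hpq) = single m m t +
      single p q (φ (t • matrixUnit hρ (hρ.refl m) + u • matrixUnit hρ hpq) p q) := by
  set Z : ℂ → algebra ρ hρ := fun u => t • matrixUnit hρ (hρ.refl m) + u • matrixUnit hρ hpq
    with hZ
  change φ (Z u) = single m m t + single p q (φ (Z u) p q)
  have hZc : Continuous Z := by fun_prop
  have hZt : ∀ u, Z u * Z u = t • Z u := by
    intro u
    rcases hm with rfl | rfl <;>
    · simp only [hZ, mul_add, add_mul, smul_mul_smul_comm, matrixUnit_mul_same,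
        matrixUnit_mul_of_ne _ _ hne.symm]
      module
  have hoff : ∀ u r s, r ≠ s → ¬(r = p ∧ s = q) → φ (Z u) r s = 0 := by
    intro u r s hrs h1
    by_cases h2 : r = q ∧ s = p
    · exact h2.1 ▸ h2.2 ▸ htri u
    by_cases hr : r = p ∨ r = q
    · have hi : p ≠ s := by rintro rfl; tauto
      have hj : q ≠ s := by rintro rfl; tauto
      have hms : m ≠ s := by rcases hm with rfl | rfl <;> assumption
      refine (hφ.map_apply_eq_zero (m := s) ?_).1 r hrs
      simp [hZ, add_mul, mul_add, matrixUnit_mul_of_ne, hi.symm, hj, hms, hms.symm]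
    · push Not at hr
      have hms : m ≠ r := by rcases hm with rfl | rfl <;> tauto
      refine (hφ.map_apply_eq_zero (m := r) ?_).2 s hrs.symm
      simp [hZ, add_mul, mul_add, matrixUnit_mul_of_ne, hr.1, hr.2.symm, hms, hms.symm]
  have hdiag : ∀ r, φ (Z u) r r = φ (Z 0) r r := fun r => by
    refine hφ.map_diag_apply_eq hZc hZt (fun v => ?_) u
    by_cases hr : r = q
    · exact mem_spectrum_of_row fun s hs => hoff v r s hs.symm fun h => hne (h.1.symm.trans hr)
    · exact mem_spectrum_of_col fun s hs => hoff v s r hs fun h => hr h.2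
  have h0 : φ (Z 0) = single m m t := by simp [hZ, hφ.map_smul_unit_self]
  ext r s
  by_cases hrs : r = s
  · subst hrs
    have : ¬(p = r ∧ q = r) := fun h => hne (h.1.trans h.2.symm)
    rw [hdiag, h0, Matrix.add_apply, single_apply_of_ne _ _ _ _ _ this, add_zero]
  · have h3 : ¬(m = r ∧ m = s) := fun h => hrs (h.1.symm.trans h.2)
    rw [Matrix.add_apply, single_apply_of_ne _ _ _ _ _ h3, zero_add]
    by_cases h1 : r = p ∧ s = q
    · obtain ⟨rfl, rfl⟩ := h1
      simp
    · rw [hoff u r s hrs h1, single_apply_of_ne]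
      exact fun h => h1 ⟨h.1.symm, h.2.symm⟩

/-- Links the three coefficients through the vanishing product of C = tE_ii - E_ij and A = t²E_kk -
E_ik - tE_jk. The image of C is read off from tE_jj + E_ij, and that of A from t²E_ii + E_ik and
tE_jj + E_jk. -/
theorem coeff_mul_coeff (hφ : IsNormalized φ) {i j k : Fin n} (hij : (i, j) ∈ ρ)
    (hjk : (j, k) ∈ ρ) (hik : (i, k) ∈ ρ) (nij : i ≠ j) (njk : j ≠ k) (nik : i ≠ k)
    {c d e : ℂ} (hd : d ≠ 0) (he : e ≠ 0)
    (hc' : φ (matrixUnit hρ hij) = single i j c) (hd' : φ (matrixUnit hρ hjk) = single j k d)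
    (he' : φ (matrixUnit hρ hik) = single i k e) : c * d = e := by
  have nji := nij.symm
  have nkj := njk.symm
  have nki := nik.symm
  set U : Fin n → algebra ρ hρ := fun m => matrixUnit hρ (hρ.refl m) with hU
  set Eij := matrixUnit hρ hij with hEij
  set Ejk := matrixUnit hρ hjk with hEjk
  set Eik := matrixUnit hρ hik with hEik
  -- The images of the three families of multiples of idempotents with one off-diagonal entry.
  have hB : ∀ t u : ℂ, φ (t • U j + u • Eij) =
      single j j t + single i j (φ (t • U j + u • Eij) i j) := by
    refine fun t => hφ.map_add_smul_unit hij nij (Or.inr rfl) t fun u => ?_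
    have h := hφ.comm (t • U j + u • Eij) Eik (by
      simp [hU, hEij, hEik, add_mul, mul_add, matrixUnit_mul_of_ne, nji, nkj, nki])
    rw [he'] at h
    exact (apply_eq_zero_of_commute_single he h).1 j nji
  have hB' : ∀ t u : ℂ, φ (t • U j + u • Ejk) =
      single j j t + single j k (φ (t • U j + u • Ejk) j k) := by
    refine fun t => hφ.map_add_smul_unit hjk njk (Or.inl rfl) t fun u => ?_
    have h := hφ.comm (t • U j + u • Ejk) Eik (by
      simp [hU, hEjk, hEik, add_mul, mul_add, matrixUnit_mul_of_ne, nji, nkj, nki])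
    rw [he'] at h
    exact (apply_eq_zero_of_commute_single he h).2 j njk
  have hD : ∀ t u : ℂ, φ (t • U i + u • Eik) =
      single i i t + single i k (φ (t • U i + u • Eik) i k) := by
    refine fun t => hφ.map_add_smul_unit hik nik (Or.inl rfl) t fun u => ?_
    have h := hφ.comm (t • U i + u • Eik) Ejk (by
      simp [hU, hEjk, hEik, add_mul, mul_add, matrixUnit_mul_of_ne, nij, nkj, nki])
    rw [hd'] at h
    exact (apply_eq_zero_of_commute_single hd h).2 i nik
  set b : ℂ → ℂ → ℂ := fun t u => φ (t • U j + u • Eij) i j with hb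
  set b' : ℂ → ℂ → ℂ := fun t u => φ (t • U j + u • Ejk) j k with hb'
  set a : ℂ → ℂ → ℂ := fun t u => φ (t • U i + u • Eik) i k with ha
  have key : ∀ t : ℂ, t ≠ 0 → b t 1 * b' t 1 = a (t * t) 1 := by
    intro t ht
    have hC : φ (t • U i + (-1 : ℂ) • Eij) = single i i t + single i j (-b t 1) := by
      -- tE_ii + uE_ij does not commute with `Eik`, but it annihilates tE_jj - uE_ij on both sides.
      have hcomm : ∀ u : ℂ, φ (t • U i + u • Eij) * (single j j t + single i j (b t (-u))) =
          (single j j t + single i j (b t (-u))) * φ (t • U i + u • Eij) := fun u => by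
        rw [← hB]
        refine hφ.comm _ _ ?_
        simp only [hU, hEij, add_mul, mul_add, smul_mul_smul_comm, matrixUnit_mul_same,
          matrixUnit_mul_of_ne _ _ nji, matrixUnit_mul_of_ne _ _ nij]
        module
      have htri : ∀ u : ℂ, φ (t • U i + u • Eij) j i = 0 := fun u => by
        have h := congr_fun (congr_fun (hcomm u) j) i
        simpa [mul_add, add_mul, mul_single_apply, single_mul_apply, nij, nji, ht] using h
      have h1 := hφ.map_add_smul_unit hij nij (Or.inl rfl) t htri (-1)
      have h2 := congr_fun (congr_fun (hcomm (-1)) i) j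
      change φ (t • U i + (-1 : ℂ) • Eij) = single i i t +
        single i j (φ (t • U i + (-1 : ℂ) • Eij) i j) at h1
      generalize φ (t • U i + (-1 : ℂ) • Eij) i j = x at h1
      rw [h1] at h2 ⊢
      simp [mul_add, add_mul, nij, nji] at h2
      have h3 : t * (x + b t 1) = 0 := by linear_combination h2
      rw [eq_neg_of_add_eq_zero_left ((mul_eq_zero.1 h3).resolve_left ht)]
    -- The coefficients make A(u) annihilate both t²E_ii + uE_ik and tE_jj + uE_jk, and A(1)
    -- annihilate C; u deforms A(1) to a diagonal matrix.
    set A : ℂ → algebra ρ hρ := fun u => (t * t) • U k + (-u) • Eik + (-(u * t)) • Ejk with hA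
    have hAc : Continuous A := by fun_prop
    have hAA : ∀ u, A u * A u = (t * t) • A u := fun u => by
      simp only [hA, hU, hEik, hEjk, add_mul, mul_add, smul_mul_smul_comm, matrixUnit_mul_same,
        matrixUnit_mul_of_ne _ _ nki, matrixUnit_mul_of_ne _ _ nkj]
      module
    have hAP : ∀ u, φ (A u) * (single i i (t * t) + single i k (a (t * t) u)) =
        (single i i (t * t) + single i k (a (t * t) u)) * φ (A u) := fun u => by
      rw [← hD]
      refine hφ.comm _ _ ?_
      simp only [hA, hU, hEik, hEjk, add_mul, mul_add, smul_mul_smul_comm, matrixUnit_mul_same,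
        matrixUnit_mul_of_ne _ _ nki, matrixUnit_mul_of_ne _ _ nkj,
        matrixUnit_mul_of_ne _ _ nij, matrixUnit_mul_of_ne _ _ nik]
      module
    have hAQ : ∀ u, φ (A u) * (single j j t + single j k (b' t u)) =
        (single j j t + single j k (b' t u)) * φ (A u) := fun u => by
      rw [← hB']
      refine hφ.comm _ _ ?_
      simp only [hA, hU, hEik, hEjk, add_mul, mul_add, smul_mul_smul_comm, matrixUnit_mul_same,
        matrixUnit_mul_of_ne _ _ nki, matrixUnit_mul_of_ne _ _ nkj,
        matrixUnit_mul_of_ne _ _ nji, matrixUnit_mul_of_ne _ _ njk]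
      module
    have hcoli : ∀ u r, r ≠ i → φ (A u) r i = 0 := fun u r hr => by
      have h := congr_fun (congr_fun (hAP u) r) i
      simpa [mul_add, add_mul, mul_single_apply, single_mul_apply, hr.symm, nki, ht] using h
    have hcolj : ∀ u r, r ≠ j → φ (A u) r j = 0 := fun u r hr => by
      have h := congr_fun (congr_fun (hAQ u) r) j
      simpa [mul_add, add_mul, mul_single_apply, single_mul_apply, hr.symm, nkj, ht] using h
    have hrowk : ∀ u s, s ≠ k → φ (A u) k s = 0 := fun u s hs => by
      by_cases hsi : s = i
      · exact hsi ▸ hcoli u k nki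
      by_cases hsj : s = j
      · exact hsj ▸ hcolj u k nkj
      refine (hφ.map_apply_eq_zero (m := s) ?_).1 k hs.symm
      simp [hA, hU, hEik, hEjk, add_mul, mul_add, matrixUnit_mul_of_ne, hs, hs.symm, hsi, hsj,
        -neg_smul]
    have hA0 : φ (A 0) = single k k (t * t) := by
      simp [hA, hU, hφ.map_smul_unit_self]
    have hAii : φ (A 1) i i = 0 := by
      rw [hφ.map_diag_apply_eq hAc hAA (fun u => mem_spectrum_of_col (hcoli u)) 1, hA0]
      simp [nki]
    have hAjj : φ (A 1) j j = 0 := by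
      rw [hφ.map_diag_apply_eq hAc hAA (fun u => mem_spectrum_of_col (hcolj u)) 1, hA0]
      simp [nkj]
    have hAkk : φ (A 1) k k = t * t := by
      rw [hφ.map_diag_apply_eq hAc hAA (fun u => mem_spectrum_of_row (hrowk u)) 1, hA0]
      simp
    have hAik : φ (A 1) i k = -a (t * t) 1 := by
      have h := congr_fun (congr_fun (hAP 1) i) k
      simp [mul_add, add_mul, mul_single_apply, nik, hAii, hAkk] at h
      have h3 : t * t * (φ (A 1) i k + a (t * t) 1) = 0 := by linear_combination -h
      exact eq_neg_of_add_eq_zero_left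
        ((mul_eq_zero.1 h3).resolve_left (mul_ne_zero ht ht))
    have hAjk : φ (A 1) j k = -(t * b' t 1) := by
      have h := congr_fun (congr_fun (hAQ 1) j) k
      simp [mul_add, add_mul, mul_single_apply, njk, hAjj, hAkk] at h
      have h3 : t * (φ (A 1) j k + t * b' t 1) = 0 := by linear_combination -h
      exact eq_neg_of_add_eq_zero_left ((mul_eq_zero.1 h3).resolve_left ht)
    have hCA := hφ.comm (t • U i + (-1 : ℂ) • Eij) (A 1) (by
      simp only [hA, hU, hEik, hEjk, hEij, add_mul, mul_add, smul_mul_smul_comm,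
        matrixUnit_mul_same, matrixUnit_mul_of_ne _ _ nki, matrixUnit_mul_of_ne _ _ nik,
        matrixUnit_mul_of_ne _ _ nij, matrixUnit_mul_of_ne _ _ nji, matrixUnit_mul_of_ne _ _ njk]
      module)
    rw [hC] at hCA
    -- The (i,k) entry reads t b b' - t a = 0.
    have h := congr_fun (congr_fun hCA i) k
    simp [mul_add, add_mul, mul_single_apply, nik, njk, hAik, hAjk] at h
    have h3 : t * (b t 1 * b' t 1 - a (t * t) 1) = 0 := by linear_combination h
    exact sub_eq_zero.1 ((mul_eq_zero.1 h3).resolve_left ht)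
  have hφc := hφ.cont
  have hcont1 : Continuous fun t => b t 1 * b' t 1 := by
    refine Continuous.mul ?_ ?_ <;> exact (hφc.comp (by fun_prop)).matrix_elem _ _
  have hcont2 : Continuous fun t => a (t * t) 1 :=
    (hφc.comp (by fun_prop)).matrix_elem _ _
  -- At t = 0 the three families become the matrix units themselves.
  have h0 := congr_fun (Continuous.ext_on (dense_compl_singleton (0 : ℂ)) hcont1 hcont2 key) 0
  simpa [ha, hb, hb', hc', hd', he'] using h0

theorem coeff_mul_coeff_of_isDirect (hφ : IsNormalized φ) (h2 : IsTwoFree ρ hρ) {i j k : Fin n}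
    (hij : (i, j) ∈ ρ) (hjk : (j, k) ∈ ρ) (hik : (i, k) ∈ ρ) {c d e : ℂ}
    (hc : c ≠ 0) (hd : d ≠ 0) (he : e ≠ 0)
    (hc' : φ (matrixUnit hρ hij) = single i j c) (hd' : φ (matrixUnit hρ hjk) = single j k d)
    (he' : φ (matrixUnit hρ hik) = single i k e) : c * d = e := by
  have single_inj : ∀ {p q : Fin n} {x y : ℂ}, single p q x = single p q y → x = y :=
    fun {p q x y} h => by simpa using congr_fun (congr_fun h p) q
  have coeff_self : ∀ {m : Fin n} {x : ℂ} (hm : (m, m) ∈ ρ),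
      φ (matrixUnit hρ hm) = single m m x → x = 1 := fun hm h => by
    rw [hφ.map_unit_self] at h
    exact (single_inj h).symm
  by_cases nij : i = j
  · subst nij
    rw [coeff_self _ hc', one_mul]
    exact single_inj (hd'.symm.trans he')
  by_cases njk : j = k
  · subst njk
    rw [coeff_self _ hd', mul_one]
    exact single_inj (hc'.symm.trans he')
  by_cases nik : i = k
  · subst nik
    rw [coeff_self _ he']
    -- Here cd = 1 is needed. With x, y the coefficients of (i,l), (j,l), the distinct-index case
    -- gives cy = x and dx = y; targets work alike.
    obtain ⟨l, nli, nlj, hl⟩ := exists_third h2 hij nij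
    have dij : IsDirect φ i j := ⟨hij, c, hc, hc'⟩
    have dji : IsDirect φ j i := ⟨hjk, d, hd, hd'⟩
    rcases hl with hl | hl
    · have dil := hφ.isDirect_of_source dij hl nij nlj.symm
      obtain ⟨hil, x, hx, hx'⟩ := id dil
      obtain ⟨hjl, y, hy, hy'⟩ := hφ.isDirect_trans dji dil
      have e1 := hφ.coeff_mul_coeff hij hjl hil nij nlj.symm nli.symm hy hx hc' hy' hx'
      have e2 := hφ.coeff_mul_coeff hjk hil hjl njk nli.symm nlj.symm hx hy hd' hx' hy'
      exact mul_right_cancel₀ hx (by linear_combination c * e2 + e1)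
    · have dlj := hφ.isDirect_of_target dij hl njk nli.symm
      obtain ⟨hlj, x, hx, hx'⟩ := id dlj
      obtain ⟨hli, y, hy, hy'⟩ := hφ.isDirect_trans dlj dji
      have e1 := hφ.coeff_mul_coeff hli hij hlj nli nij nlj hc hx hy' hc' hx'
      have e2 := hφ.coeff_mul_coeff hlj hjk hli nlj njk nli hd hy hx' hd' hy'
      exact mul_right_cancel₀ hx (by linear_combination c * e2 + e1)
  exact hφ.coeff_mul_coeff hij hjk hik nij njk nik hd he hc' hd' he'

end IsNormalized

end Units
end SMA

/-! ### Assembly -/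

theorem mainTheorem2 (n : ℕ) (ρ : Set (Fin n × Fin n)) (hρ : SMA.IsQuasiOrder ρ)
    (h2 : SMA.IsTwoFree ρ hρ)
    (φ : SMA.algebra ρ hρ → Matrix (Fin n) (Fin n) ℂ)
    (hinj : Function.Injective φ) (hcont : Continuous φ)
    (hcomm : SMA.PreservesCommutativity φ) (hspec : SMA.PreservesSpectrum φ) :
    ∃ (S : (Matrix (Fin n) (Fin n) ℂ)ˣ) (g : ρ → ℂˣ) (ρM ρA : Set (Fin n × Fin n)),
      SMA.IsTransitiveMap hρ g ∧
      SMA.IsQuasiOrder ρM ∧ SMA.IsQuasiOrder ρA ∧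
      ρM ∪ ρA = ρ ∧ ρM ∩ ρA = {p | p.1 = p.2} ∧
      ∀ (i j : Fin n) (h : (i, j) ∈ ρ),
        ((i, j) ∈ ρM →
          φ (SMA.matrixUnit hρ h) = (g ⟨(i, j), h⟩ : ℂ) •
            ((S : Matrix (Fin n) (Fin n) ℂ) * Matrix.single i j 1 *
              ((S⁻¹ : (Matrix (Fin n) (Fin n) ℂ)ˣ) : Matrix (Fin n) (Fin n) ℂ))) ∧
        ((i, j) ∈ ρA →
          φ (SMA.matrixUnit hρ h) = (g ⟨(i, j), h⟩ : ℂ) •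
            ((S : Matrix (Fin n) (Fin n) ℂ) * Matrix.single j i 1 *
              ((S⁻¹ : (Matrix (Fin n) (Fin n) ℂ)ˣ) : Matrix (Fin n) (Fin n) ℂ))) := by
  obtain ⟨S, ψ, hψ, hφψ⟩ := SMA.exists_isNormalized hinj hcont hcomm hspec
  have hψT := hψ.transpose
  have coeff : ∀ p : ρ, ∃ c : ℂˣ,
      (SMA.IsDirect ψ p.1.1 p.1.2 →
        ψ (SMA.matrixUnit hρ p.2) = Matrix.single p.1.1 p.1.2 (c : ℂ)) ∧
      (SMA.IsReversed ψ p.1.1 p.1.2 →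
        ψ (SMA.matrixUnit hρ p.2) = Matrix.single p.1.2 p.1.1 (c : ℂ)) := by
    rintro ⟨⟨i, j⟩, hij⟩
    by_cases nij : i = j
    · subst nij
      exact ⟨1, fun _ => hψ.map_unit_self i, fun _ => hψ.map_unit_self i⟩
    rcases hψ.isDirect_or_isReversed h2 hij with h | h
    · obtain ⟨_, c, hc, hc'⟩ := id h
      exact ⟨Units.mk0 c hc, fun _ => hc',
        fun h' => (SMA.not_isDirect_and_isReversed nij h h').elim⟩
    · obtain ⟨_, c, hc, hc'⟩ := id h
      exact ⟨Units.mk0 c hc, fun h' => (SMA.not_isDirect_and_isReversed nij h' h).elim,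
        fun _ => hc'⟩
  choose g hgM hgA using coeff
  have hself : ∀ i, SMA.IsDirect ψ i i := hψ.isDirect_self
  have hself' : ∀ i, SMA.IsReversed ψ i i := fun i => SMA.isReversed_iff.2 (hψT.isDirect_self i)
  have htransA : ∀ {i j k}, SMA.IsReversed ψ i j → SMA.IsReversed ψ j k →
      SMA.IsReversed ψ i k := fun hij hjk => SMA.isReversed_iff.2
    (hψT.isDirect_trans (SMA.isReversed_iff.1 hij) (SMA.isReversed_iff.1 hjk))
  refine ⟨S, g, {p | SMA.IsDirect ψ p.1 p.2}, {p | SMA.IsReversed ψ p.1 p.2}, ?_,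
    ⟨hself, fun _ _ _ => hψ.isDirect_trans⟩, ⟨hself', fun _ _ _ => htransA⟩, ?_, ?_, ?_⟩
  · intro i j k hij hjk
    have hik := hρ.trans i j k hij hjk
    -- Composable pairs can be given a common orientation; diagonal pairs count as both.
    have htype : (SMA.IsDirect ψ i j ∧ SMA.IsDirect ψ j k) ∨
        (SMA.IsReversed ψ i j ∧ SMA.IsReversed ψ j k) := by
      by_cases nij : i = j
      · subst nij
        exact (hψ.isDirect_or_isReversed h2 hjk).imp (fun h => ⟨hself i, h⟩)
          fun h => ⟨hself' i, h⟩
      · refine (hψ.isDirect_or_isReversed h2 hij).imp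
          (fun h => ⟨h, hψ.isDirect_of_adjacent h2 h hjk nij⟩) fun h => ⟨h, ?_⟩
        exact SMA.isReversed_iff.2
          (hψT.isDirect_of_adjacent h2 (SMA.isReversed_iff.1 h) hjk nij)
    apply Units.ext
    rw [Units.val_mul]
    rcases htype with ⟨h1, h3⟩ | ⟨h1, h3⟩
    · exact hψ.coeff_mul_coeff_of_isDirect h2 hij hjk hik (Units.ne_zero _) (Units.ne_zero _)
        (Units.ne_zero _) (hgM ⟨(i, j), hij⟩ h1) (hgM ⟨(j, k), hjk⟩ h3)
        (hgM ⟨(i, k), hik⟩ (hψ.isDirect_trans h1 h3))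
    · have hT : ∀ p : ρ, SMA.IsReversed ψ p.1.1 p.1.2 →
          (ψ (SMA.matrixUnit hρ p.2)).transpose = Matrix.single p.1.1 p.1.2 (g p : ℂ) :=
        fun p hp => by rw [hgA p hp, Matrix.transpose_single]
      exact hψT.coeff_mul_coeff_of_isDirect h2 hij hjk hik (Units.ne_zero _) (Units.ne_zero _)
        (Units.ne_zero _) (hT ⟨(i, j), hij⟩ h1) (hT ⟨(j, k), hjk⟩ h3)
        (hT ⟨(i, k), hik⟩ (htransA h1 h3))
  · ext ⟨i, j⟩
    exact ⟨fun h => h.elim (fun h => h.1) fun h => h.1, hψ.isDirect_or_isReversed h2⟩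
  · ext ⟨i, j⟩
    constructor
    · rintro ⟨h1, h3⟩
      by_contra nij
      exact SMA.not_isDirect_and_isReversed nij h1 h3
    · rintro (rfl : i = j)
      exact ⟨hself i, hself' i⟩
  · intro i j h
    have hs : ∀ (a b : Fin n) (c : ℂ), Matrix.single a b c = c • Matrix.single a b 1 :=
      fun a b c => by rw [Matrix.smul_single, smul_eq_mul, mul_one]
    refine ⟨fun hM => ?_, fun hA => ?_⟩
    · rw [hφψ, hgM ⟨(i, j), h⟩ hM, hs, mul_smul_comm, smul_mul_assoc]
    · rw [hφψ, hgA ⟨(i, j), h⟩ hA, hs, mul_smul_comm, smul_mul_assoc]
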